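/- Let $X$ be an $n$-dimensional complex manifold, $k\ge 0$ an integer and $k'=\frac{k(k+1)}2$. Let $p_k:J_kX\to X$ be the space of $k$-jets $[\gamma]_k$ of germs of holomorphic curves $\gamma:(\mathbb C,0)\to X$, with $p_k([\gamma]_k)=\gamma(0)$ and with the complex structure given by the coordinates $(z,z',\dots,z^{(k)})$ induced by charts of $X$. Let $\mathbb G_k$ be the group of $k$-jets $\varphi:t\mapsto a_1t+\cdots+a_kt^k$, $a_1\ne0$, of biholomorphisms of $(\mathbb C,0)$ (the trivial group if $k=0$), acting by $\varphi\cdot[\gamma]_k=[\gamma\circ\varphi]_k$. For $U\subset X$ open, let $E_{k,m}T_X^*(U)$ be the space of invariant jet differentials of order $k$ and weighted degree $m$ on $U$: the holomorphic functions $Q$ on $p_k^{-1}(U)$ with $Q(\varphi\cdot[\gamma]_k)=\varphi'(0)^mQ([\gamma]_k)$ for all $[\gamma]_k\in p_k^{-1}(U)$ and $\varphi\in\mathbb G_k$ (with $0^0=1$ when $k=m=0$). For $f\in\mathcal O(U)$ and $0\le p\le k$ put $d_U^{[p]}f([\gamma]_k)=(f\circ\gamma)^{(p)}(0)$, and for $f_0,\dots,f_k\in\mathcal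 O(U)$ put $$W_U(f_0,\dots,f_k)=\det\big(d_U^{[p]}f_j\big)_{0\le p,j\le k}.$$ (1) For every open $U\subset X$ and all $f_0,\dots,f_k\in\mathcal O(U)$ one has $W_U(f_0,\dots,f_k)\in E_{k,k'}T_X^*(U)$. (2) Let $L$ be a holomorphic line bundle on $X$ and $s_0,\dots,s_k\in H^0(X,L)$. For a holomorphic trivialization of $L$ over an open set $U$, let $s_{j,U}\in\mathcal O(U)$ be the function representing $s_j$, and set $W_U(s_0,\dots,s_k)=W_U(s_{0,U},\dots,s_{k,U})$; by (1) it lies in $E_{k,k'}T_X^*(U)$. These local jet differentials glue together: there is a unique section $$W(s_0,\dots,s_k)\in H^0\big(X,E_{k,k'}T_X^*\otimes L^{k+1}\big)$$ which, for every open $U$ and every holomorphic trivialization of $L$ over $U$, is represented by $W_U(s_0,\dots,s_k)$ in the induced trivialization of $L^{k+1}$ over $U$. -/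

import Mathlib

open scoped Manifold ContDiff

noncomputable section

namespace JetDifferentials

open Bundle TensorProduct TopologicalSpace

/-- `ℂⁿ`, the model space of `n`-dimensional complex manifolds.  A complex manifold of dimension `n`
is a space `X` with `[ChartedSpace (Cn n) X] [IsManifold 𝓘(ℂ, Cn n) ω X]`. -/
abbrev Cn (n : ℕ) := EuclideanSpace ℂ (Fin n)

section Jets

variable (n : ℕ) (X : Type*) [TopologicalSpace X] [ChartedSpace (Cn n) X]

/-- Germs of holomorphic curves `(ℂ, 0) → X`, each given by a representative: a map `ℂ → X` that is
holomorphic (i.e. complex analytic) near `0`; its values far from `0` are irrelevant. -/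
structure CurveGerm where
  toFun : ℂ → X
  holomorphic_at_zero : ContMDiffAt 𝓘(ℂ, ℂ) 𝓘(ℂ, Cn n) ω toFun 0

variable {n X}

/-- Two curves have the same `k`-jet if they pass through the same point at time `0` and their
derivatives at `0` up to order `k` coincide in every coordinate chart around that point. -/
def SameJet (k : ℕ) (γ₁ γ₂ : CurveGerm n X) : Prop :=
  γ₁.toFun 0 = γ₂.toFun 0 ∧
    ∀ φ ∈ IsManifold.maximalAtlas 𝓘(ℂ, Cn n) ω X, γ₁.toFun 0 ∈ φ.source →
      ∀ p ≤ k, iteratedDeriv p (φ ∘ γ₁.toFun) 0 = iteratedDeriv p (φ ∘ γ₂.toFun) 0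

variable (n X) in
/-- The equivalence relation defining `k`-jets of curves. -/
def jetSetoid (k : ℕ) : Setoid (CurveGerm n X) where
  r := SameJet k
  iseqv :=
    { refl := fun _ => ⟨rfl, fun _ _ _ _ _ => rfl⟩
      symm := fun h => ⟨h.1.symm, fun φ hφ hs p hp => (h.2 φ hφ (h.1 ▸ hs) p hp).symm⟩
      trans := fun h h' => ⟨h.1.trans h'.1, fun φ hφ hs p hp =>
        (h.2 φ hφ hs p hp).trans (h'.2 φ hφ (h.1 ▸ hs) p hp)⟩ }

variable (n X) in
/-- The `k`-th order jet space `J_k X`. -/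
def JetSpace (k : ℕ) := Quotient (jetSetoid n X k)

/-- The class `[γ]_k`. -/
def jet (k : ℕ) (γ : CurveGerm n X) : JetSpace n X k := Quotient.mk (jetSetoid n X k) γ

/-- The projection `p_k : J_k X → X`, `[γ]_k ↦ γ(0)`. -/
def JetSpace.base {k : ℕ} (j : JetSpace n X k) : X :=
  Quotient.lift (fun γ : CurveGerm n X => γ.toFun 0)
    (fun γ₁ γ₂ (h : SameJet k γ₁ γ₂) => h.1) j

variable (n) in
/-- `p_k⁻¹(U)`. -/
def jetsOver (k : ℕ) (U : Opens X) : Set (JetSpace n X k) := {j | j.base ∈ U}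

/-- The coordinates `(z, z', …, z^{(k)})` of the `k`-jet of a curve induced by a chart of `X`. -/
def jetCoord (k : ℕ) (φ : OpenPartialHomeomorph X (Cn n)) (γ : CurveGerm n X) :
    Fin (k + 1) → Cn n :=
  fun p => iteratedDeriv p (φ ∘ γ.toFun) 0

/-- `Q ∈ 𝒪(p_k⁻¹(U))`: in the coordinates on jets induced by any chart of `X`, the function `Q` is
a holomorphic function on the open set of all coordinate vectors of jets lying over `U`. -/
def IsHolomorphicOnJets {k : ℕ} {U : Opens X} (Q : jetsOver n k U → ℂ) : Prop :=
  ∀ φ ∈ IsManifold.maximalAtlas 𝓘(ℂ, Cn n) ω X,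
    ∃ q : (Fin (k + 1) → Cn n) → ℂ,
      AnalyticOnNhd ℂ q {v | v 0 ∈ φ.target ∧ φ.symm (v 0) ∈ U} ∧
      ∀ (γ : CurveGerm n X) (hγ : jet k γ ∈ jetsOver n k U), γ.toFun 0 ∈ φ.source →
        Q ⟨jet k γ, hγ⟩ = q (jetCoord k φ γ)

end Jets

section Composition

/-- Derivatives up to order `p` of a composition at a point only depend on the derivatives up to
order `p` of the inner function. -/
theorem iteratedDeriv_comp_congr {E F : Type*} [NormedAddCommGroup E] [NormedSpace ℂ E]
    [NormedAddCommGroup F] [NormedSpace ℂ F] {g : E → F} {h₁ h₂ : ℂ → E} {p : ℕ}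
    (hg : ContDiffAt ℂ p g (h₁ 0)) (hh₁ : ContDiffAt ℂ p h₁ 0) (hh₂ : ContDiffAt ℂ p h₂ 0)
    (h : ∀ i ≤ p, iteratedDeriv i h₁ 0 = iteratedDeriv i h₂ 0) :
    iteratedDeriv p (g ∘ h₁) 0 = iteratedDeriv p (g ∘ h₂) 0 := by
  have h0 : h₁ 0 = h₂ 0 := by simpa using h 0 (Nat.zero_le _)
  have key : ∀ i ≤ p, iteratedFDeriv ℂ i h₁ 0 = iteratedFDeriv ℂ i h₂ 0 := by
    intro i hi
    simp only [iteratedFDeriv_eq_equiv_comp, Function.comp_apply, h i hi]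
  simp only [iteratedDeriv_eq_iteratedFDeriv]
  rw [iteratedFDeriv_comp hg hh₁ le_rfl, iteratedFDeriv_comp (h0 ▸ hg) hh₂ le_rfl]
  congr 1
  simp only [FormalMultilinearSeries.taylorComp, ← h0]
  refine Finset.sum_congr rfl fun c _ => ?_
  simp only [FormalMultilinearSeries.compAlongOrderedFinpartition]
  congr 1
  funext i
  exact key _ (c.partSize_le i)

variable {n : ℕ} {X : Type*} [TopologicalSpace X] [ChartedSpace (Cn n) X]

/-- The coordinate expression of a holomorphic curve is holomorphic. -/
theorem CurveGerm.contDiffAt_chart [IsManifold 𝓘(ℂ, Cn n) ω X] (γ : CurveGerm n X)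
    {φ : OpenPartialHomeomorph X (Cn n)}
    (hφ : φ ∈ IsManifold.maximalAtlas 𝓘(ℂ, Cn n) ω X) (h : γ.toFun 0 ∈ φ.source) :
    ContDiffAt ℂ ω (φ ∘ γ.toFun) 0 :=
  ((contMDiffAt_of_mem_maximalAtlas hφ h).comp 0 γ.holomorphic_at_zero).contDiffAt

/-- If `f` is holomorphic near `γ(0)`, then `(f ∘ γ)^{(p)}(0)` for `p ≤ k` only depends on the
`k`-jet of `γ`. -/
theorem SameJet.iteratedDeriv_comp [IsManifold 𝓘(ℂ, Cn n) ω X] {k : ℕ} {γ₁ γ₂ : CurveGerm n X}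
    (h : SameJet k γ₁ γ₂) {f : X → ℂ} (hf : ContMDiffAt 𝓘(ℂ, Cn n) 𝓘(ℂ, ℂ) ω f (γ₁.toFun 0))
    {p : ℕ} (hp : p ≤ k) :
    iteratedDeriv p (f ∘ γ₁.toFun) 0 = iteratedDeriv p (f ∘ γ₂.toFun) 0 := by
  let φ := chartAt (Cn n) (γ₁.toFun 0)
  have hφ : φ ∈ IsManifold.maximalAtlas 𝓘(ℂ, Cn n) ω X := IsManifold.chart_mem_maximalAtlas _
  have hs₁ : γ₁.toFun 0 ∈ φ.source := mem_chart_source _ _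
  have hs₂ : γ₂.toFun 0 ∈ φ.source := h.1 ▸ hs₁
  have ev : ∀ γ : CurveGerm n X, γ.toFun 0 ∈ φ.source →
      f ∘ γ.toFun =ᶠ[nhds 0] (f ∘ φ.symm) ∘ (φ ∘ γ.toFun) := by
    intro γ hγ
    filter_upwards [γ.holomorphic_at_zero.continuousAt (φ.open_source.mem_nhds hγ)] with t ht
    have ht' : γ.toFun t ∈ φ.source := ht
    simp only [Function.comp_apply, φ.left_inv ht']
  rw [(ev γ₁ hs₁).iteratedDeriv_eq, (ev γ₂ hs₂).iteratedDeriv_eq]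
  refine iteratedDeriv_comp_congr ?_ ((γ₁.contDiffAt_chart hφ hs₁).of_le le_top)
    ((γ₂.contDiffAt_chart hφ hs₂).of_le le_top)
    fun i hi => h.2 φ hφ hs₁ i (hi.trans hp)
  have hsymm : ContMDiffAt 𝓘(ℂ, Cn n) 𝓘(ℂ, Cn n) ω φ.symm (φ (γ₁.toFun 0)) :=
    contMDiffAt_symm_of_mem_maximalAtlas hφ (φ.map_source hs₁)
  have hf' : ContMDiffAt 𝓘(ℂ, Cn n) 𝓘(ℂ, ℂ) ω f (φ.symm (φ (γ₁.toFun 0))) := by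
    rwa [φ.left_inv hs₁]
  exact (hf'.comp _ hsymm).contDiffAt.of_le le_top

end Composition

section Invariance

/-- The elements `φ : t ↦ a₁ t + a₂ t² + ⋯ + a_k t^k`, `a₁ ≠ 0`, of the group `𝔾_k` of `k`-jets of
biholomorphisms of `(ℂ, 0)`; here `a_{i+1}` is `coeff i`.  For `k = 0` this is the trivial group. -/
structure Reparam (k : ℕ) where
  coeff : Fin k → ℂ
  first_ne_zero : ∀ h : 0 < k, coeff ⟨0, h⟩ ≠ 0

/-- The polynomial function `t ↦ a₁ t + ⋯ + a_k t^k`. -/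
def Reparam.toFun {k : ℕ} (φ : Reparam k) (t : ℂ) : ℂ := ∑ i : Fin k, φ.coeff i * t ^ ((i : ℕ) + 1)

theorem Reparam.toFun_zero {k : ℕ} (φ : Reparam k) : φ.toFun 0 = 0 := by
  simp [Reparam.toFun]

theorem Reparam.contDiff {k : ℕ} (φ : Reparam k) : ContDiff ℂ ω φ.toFun := by
  unfold Reparam.toFun
  exact ContDiff.sum fun i _ => contDiff_const.mul (contDiff_id.pow _)

variable {n : ℕ} {X : Type*} [TopologicalSpace X] [ChartedSpace (Cn n) X]

/-- The reparametrized curve `γ ∘ φ`. -/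
def CurveGerm.reparam {k : ℕ} (γ : CurveGerm n X) (φ : Reparam k) : CurveGerm n X where
  toFun := γ.toFun ∘ φ.toFun
  holomorphic_at_zero := by
    refine ContMDiffAt.comp 0 ?_ φ.contDiff.contMDiff.contMDiffAt
    rw [φ.toFun_zero]
    exact γ.holomorphic_at_zero

theorem SameJet.reparam [IsManifold 𝓘(ℂ, Cn n) ω X] {k : ℕ} {γ₁ γ₂ : CurveGerm n X}
    (h : SameJet k γ₁ γ₂) (φ : Reparam k) : SameJet k (γ₁.reparam φ) (γ₂.reparam φ) := by
  have e : ∀ γ : CurveGerm n X, (γ.reparam φ).toFun 0 = γ.toFun 0 := fun γ => by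
    simp [CurveGerm.reparam, φ.toFun_zero]
  refine ⟨by rw [e, e, h.1], fun ψ hψ hs p hp => ?_⟩
  rw [e] at hs
  have hs₂ : γ₂.toFun 0 ∈ ψ.source := h.1 ▸ hs
  have hc : ContDiffAt ℂ p φ.toFun 0 := φ.contDiff.contDiffAt.of_le le_top
  have c : ∀ γ : CurveGerm n X, γ.toFun 0 ∈ ψ.source →
      ContDiffAt ℂ p (ψ ∘ γ.toFun) (φ.toFun 0) := fun γ hγ => by
    rw [φ.toFun_zero]
    exact (γ.contDiffAt_chart hψ hγ).of_le le_top
  change iteratedDeriv p ((ψ ∘ γ₁.toFun) ∘ φ.toFun) 0 = iteratedDeriv p ((ψ ∘ γ₂.toFun) ∘ φ.toFun) 0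
  simp only [iteratedDeriv_eq_iteratedFDeriv]
  rw [iteratedFDeriv_comp (c γ₁ hs) hc le_rfl, iteratedFDeriv_comp (c γ₂ hs₂) hc le_rfl]
  congr 1
  simp only [FormalMultilinearSeries.taylorComp]
  refine Finset.sum_congr rfl fun q _ => ?_
  simp only [FormalMultilinearSeries.compAlongOrderedFinpartition]
  congr 1
  rw [φ.toFun_zero]
  simp only [ftaylorSeries, iteratedFDeriv_eq_equiv_comp, Function.comp_apply,
    h.2 ψ hψ hs _ (q.length_le.trans hp)]

/-- The action `φ · [γ]_k = [γ ∘ φ]_k` of `𝔾_k` on `J_k X`. -/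
def Reparam.act [IsManifold 𝓘(ℂ, Cn n) ω X] {k : ℕ} (φ : Reparam k) :
    JetSpace n X k → JetSpace n X k :=
  Quotient.map (fun γ => γ.reparam φ) (fun _ _ h => SameJet.reparam h φ)

theorem Reparam.base_act [IsManifold 𝓘(ℂ, Cn n) ω X] {k : ℕ} (φ : Reparam k)
    (j : JetSpace n X k) : (φ.act j).base = j.base := by
  induction j using Quotient.inductionOn with
  | h γ => exact congrArg γ.toFun φ.toFun_zero

/-- The action of `𝔾_k` on `p_k⁻¹(U)`. -/
def Reparam.actOver [IsManifold 𝓘(ℂ, Cn n) ω X] {k : ℕ} {U : Opens X} (φ : Reparam k)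
    (w : jetsOver n k U) : jetsOver n k U :=
  ⟨φ.act w.1, show (φ.act w.1).base ∈ U from (φ.base_act w.1).symm ▸ w.2⟩

variable (n) in
/-- `E_{k,m}T_X^*(U)`: the space of invariant jet differentials of order `k` and (weighted) degree
`m` on `U`, i.e. of holomorphic functions `Q` on `p_k⁻¹(U)` such that
`Q(φ · [γ]_k) = φ'(0)^m Q([γ]_k)` for all `φ ∈ 𝔾_k`. -/
def invJetDiff [IsManifold 𝓘(ℂ, Cn n) ω X] (k m : ℕ) (U : Opens X) :
    Submodule ℂ (jetsOver n k U → ℂ) where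
  carrier := {Q | IsHolomorphicOnJets Q ∧
    ∀ (φ : Reparam k) (w : jetsOver n k U), Q (φ.actOver w) = deriv φ.toFun 0 ^ m * Q w}
  zero_mem' := ⟨fun _ _ => ⟨0, fun _ _ => analyticAt_const, fun _ _ _ => rfl⟩, by simp⟩
  add_mem' := by
    rintro P Q ⟨hP, hP'⟩ ⟨hQ, hQ'⟩
    refine ⟨fun φ hφ => ?_, fun φ w => ?_⟩
    · obtain ⟨a, ha, ha'⟩ := hP φ hφ
      obtain ⟨b, hb, hb'⟩ := hQ φ hφ
      exact ⟨a + b, ha.add hb, fun γ hγ hs => by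
        simp only [Pi.add_apply, ha' γ hγ hs, hb' γ hγ hs]⟩
    · simp only [Pi.add_apply, hP' φ w, hQ' φ w, mul_add]
  smul_mem' := by
    rintro c Q ⟨hQ, hQ'⟩
    refine ⟨fun φ hφ => ?_, fun φ w => ?_⟩
    · obtain ⟨b, hb, hb'⟩ := hQ φ hφ
      exact ⟨c • b, fun v hv => (hb v hv).const_smul, fun γ hγ hs => by
        simp only [Pi.smul_apply, hb' γ hγ hs]⟩
    · simp only [Pi.smul_apply, hQ' φ w, smul_eq_mul]
      ring

end Invariance

section LocalWronskian

variable {n : ℕ} {X : Type*} [TopologicalSpace X] [ChartedSpace (Cn n) X]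

variable (n) in
/-- `f ∈ 𝒪(U)`; the values of `f` outside `U` are irrelevant. -/
def IsHolomorphicOn (U : Opens X) (f : X → ℂ) : Prop :=
  ContMDiffOn 𝓘(ℂ, Cn n) 𝓘(ℂ, ℂ) ω f (U : Set X)

variable [IsManifold 𝓘(ℂ, Cn n) ω X]

/-- The function `d^{[p]}_U f : p_k⁻¹(U) → ℂ`, `[γ]_k ↦ (f ∘ γ)^{(p)}(0)`, for `f ∈ 𝒪(U)` and
`0 ≤ p ≤ k`. -/
def jetDiff {k : ℕ} {U : Opens X} {f : X → ℂ} (hf : IsHolomorphicOn n U f) (p : Fin (k + 1))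
    (w : jetsOver n k U) : ℂ :=
  Quotient.hrecOn (motive := fun j : JetSpace n X k => j.base ∈ U → ℂ) w.1
    (fun γ _ => iteratedDeriv p (f ∘ γ.toFun) 0)
    (fun γ₁ γ₂ h => by
      have h' : SameJet k γ₁ γ₂ := h
      refine Function.hfunext (congrArg (· ∈ U) h'.1) fun h₁ h₂ _ => heq_of_eq ?_
      exact h'.iteratedDeriv_comp (hf.contMDiffAt (U.isOpen.mem_nhds h₁))
        (Nat.lt_succ_iff.mp p.2)) w.2

theorem jetDiff_jet {k : ℕ} {U : Opens X} {f : X → ℂ} (hf : IsHolomorphicOn n U f)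
    (p : Fin (k + 1)) (γ : CurveGerm n X) (hγ : jet k γ ∈ jetsOver n k U) :
    jetDiff hf p ⟨jet k γ, hγ⟩ = iteratedDeriv p (f ∘ γ.toFun) 0 := rfl

/-- The Wronskian `W_U(f₀, …, f_k) = det (d^{[p]}_U f_j)_{0 ≤ p, j ≤ k}`, with row index `p` and
column index `j`, as a function on `p_k⁻¹(U)`. -/
def wronskian {k : ℕ} {U : Opens X} {f : Fin (k + 1) → X → ℂ}
    (hf : ∀ j, IsHolomorphicOn n U (f j)) (w : jetsOver n k U) : ℂ :=
  Matrix.det (Matrix.of fun p j : Fin (k + 1) => jetDiff (hf j) p w)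

end LocalWronskian

section LineBundle

variable (n : ℕ) {X : Type*} [TopologicalSpace X] [ChartedSpace (Cn n) X]
  (L : X → Type*) [TopologicalSpace (TotalSpace ℂ L)]
  [∀ x, AddCommGroup (L x)] [∀ x, Module ℂ (L x)] [∀ x, TopologicalSpace (L x)]
  [FiberBundle ℂ L]

/-- A holomorphic trivialization of the line bundle `L` over some open subset of `X` (any open
subset, and any trivialization that is fibrewise linear and biholomorphic, whether or not it belongs
to the given bundle atlas). -/
structure HolTrivialization where
  toTriv : Trivialization ℂ (π ℂ L)
  isLinear : toTriv.IsLinear ℂ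
  contMDiffOn : ContMDiffOn (𝓘(ℂ, Cn n).prod 𝓘(ℂ, ℂ)) (𝓘(ℂ, Cn n).prod 𝓘(ℂ, ℂ)) ω
    toTriv toTriv.source
  contMDiffOn_symm : ContMDiffOn (𝓘(ℂ, Cn n).prod 𝓘(ℂ, ℂ)) (𝓘(ℂ, Cn n).prod 𝓘(ℂ, ℂ)) ω
    toTriv.toOpenPartialHomeomorph.symm toTriv.target

variable {n L}

namespace HolTrivialization

/-- The open set `U` over which the trivialization is defined. -/
def domain (τ : HolTrivialization n L) : Opens X := ⟨τ.toTriv.baseSet, τ.toTriv.open_baseSet⟩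

/-- The linear map `L_x → ℂ` given by the trivialization (an isomorphism for `x ∈ U`, and `0` by
convention for `x ∉ U`). -/
def fiberMap (τ : HolTrivialization n L) (x : X) : L x →ₗ[ℂ] ℂ :=
  haveI := τ.isLinear
  τ.toTriv.linearMapAt ℂ x

/-- The induced linear map `L_x^{⊗ r} → ℂ`, `v₁ ⊗ ⋯ ⊗ v_r ↦ τ(v₁) ⋯ τ(v_r)`, i.e. the
trivialization of `L^r` induced by a trivialization `τ` of `L`. -/
def tensorMap (τ : HolTrivialization n L) (r : ℕ) (x : X) : (⨂[ℂ] _ : Fin r, L x) →ₗ[ℂ] ℂ :=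
  PiTensorProduct.lift
    ((MultilinearMap.mkPiAlgebra ℂ (Fin r) ℂ).compLinearMap fun _ => τ.fiberMap x)

/-- The function `s_U` representing a global section `s` of `L` in a trivialization over `U`. -/
def coord (τ : HolTrivialization n L) (s : Cₛ^ω⟮𝓘(ℂ, Cn n); ℂ, L⟯) (x : X) : ℂ :=
  τ.fiberMap x (s x)

theorem isHolomorphicOn_coord (τ : HolTrivialization n L) (s : Cₛ^ω⟮𝓘(ℂ, Cn n); ℂ, L⟯) :
    IsHolomorphicOn n τ.domain (τ.coord s) := by
  have := τ.isLinear
  have h : ContMDiffOn 𝓘(ℂ, Cn n) (𝓘(ℂ, Cn n).prod 𝓘(ℂ, ℂ)) ω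
      (fun x => τ.toTriv (TotalSpace.mk' ℂ x (s x))) τ.toTriv.baseSet :=
    τ.contMDiffOn.comp s.contMDiff.contMDiffOn fun x hx => τ.toTriv.mem_source.2 hx
  refine (contMDiff_snd.comp_contMDiffOn h).congr fun x hx => ?_
  have hx' : x ∈ τ.toTriv.baseSet := hx
  simp [coord, fiberMap, Trivialization.linearMapAt_apply, hx']

variable [IsManifold 𝓘(ℂ, Cn n) ω X]

/-- The local Wronskian `W_U(s₀, …, s_k) = W_U(s_{0,U}, …, s_{k,U})` of global sections of `L`,
with respect to a trivialization of `L` over `U`. -/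
def wronskian (τ : HolTrivialization n L) {k : ℕ}
    (s : Fin (k + 1) → Cₛ^ω⟮𝓘(ℂ, Cn n); ℂ, L⟯) : jetsOver n k τ.domain → ℂ :=
  JetDifferentials.wronskian fun j => τ.isHolomorphicOn_coord (s j)

/-- Given `σ(j) ∈ L_{p_k(j)}^{⊗ r}` for all jets `j`, the `ℂ`-valued function on `p_k⁻¹(U)` that
represents `σ` in the trivialization of `L^r` over `U` induced by `τ`. -/
def rep (τ : HolTrivialization n L) {k r : ℕ}
    (σ : ∀ j : JetSpace n X k, ⨂[ℂ] _ : Fin r, L j.base) : jetsOver n k τ.domain → ℂ :=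
  fun w => τ.tensorMap r w.1.base (σ w.1)

end HolTrivialization

variable [IsManifold 𝓘(ℂ, Cn n) ω X]

variable (n L) in
/-- `H⁰(X, E_{k,m}T_X^* ⊗ L^r)`.  As `E_{k,m}T_X^*` is a sheaf of functions on the jet space, its
tensor product with the line bundle `L^r` consists of the `L^r`-valued functions on the jet space,
`σ([γ]_k) ∈ L_{γ(0)}^{⊗ r}`, which in each local trivialization of `L` over an open set `U` are
represented by an element of `E_{k,m}T_X^*(U)`. -/
def twistedInvJetDiff (k m r : ℕ) :
    Submodule ℂ (∀ j : JetSpace n X k, ⨂[ℂ] _ : Fin r, L j.base) where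
  carrier := {σ | ∀ τ : HolTrivialization n L, τ.rep σ ∈ invJetDiff n k m τ.domain}
  zero_mem' := fun τ => by
    have : τ.rep (0 : ∀ j : JetSpace n X k, ⨂[ℂ] _ : Fin r, L j.base) = 0 := by
      funext w; simp [HolTrivialization.rep]
    rw [this]; exact Submodule.zero_mem _
  add_mem' := fun {σ σ'} h h' τ => by
    have : τ.rep (σ + σ') = τ.rep σ + τ.rep σ' := by
      funext w; simp [HolTrivialization.rep]
    rw [this]; exact Submodule.add_mem _ (h τ) (h' τ)
  smul_mem' := fun c σ h τ => by
    have : τ.rep (c • σ) = c • τ.rep σ := by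
      funext w; simp [HolTrivialization.rep]
    rw [this]; exact Submodule.smul_mem _ c (h τ)

end LineBundle

end JetDifferentials

end

/-! Both transformation laws of the Wronskian have one source: the matrix of derivatives gets
multiplied on the left by a lower triangular matrix, so its determinant is multiplied by the product
of the diagonal entries (`det_eq_prod_mul_det_of_lowerTriangular`). Under `γ ↦ γ ∘ φ` the triangular
matrix is that of Faà di Bruno's formula. Its diagonal entries are `φ'(0)^p` for `0 ≤ p ≤ k`, which
gives the weight `0 + 1 + ⋯ + k = k'` (`wronskian_actOver`). Under `f_j ↦ g f_j` it is that of
Leibniz' rule. All its diagonal entries are `g(γ(0))`, which gives `g^{k+1}`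
(`wronskian_eq_pow_mul`). Holomorphy on jets follows by replacing a curve in a chart by the
polynomial with the same jet coordinates (`isHolomorphicOnJets_jetDiff`). If `g` is a transition
function of `L`, then `g^{k+1}` is the transition function of `L^{k+1}`, so the local Wronskians
glue. Uniqueness holds because a trivialization of `L` induces an injection on each fibre of
`L^{k+1}` (`tensorMap_injective`). -/

namespace JetDifferentials

open Bundle TensorProduct TopologicalSpace

/-! ### Determinants under triangular row operations. -/

section LowerTriangular

/-- Row operations by a lower triangular matrix multiply the determinant by the product of the
diagonal entries. -/
theorem det_eq_prod_mul_det_of_lowerTriangular {R : Type*} [CommRing R] {m : ℕ}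
    {A A' B : Matrix (Fin m) (Fin m) R} (hA : A' = B * A) (hB : ∀ p q, p < q → B p q = 0) :
    A'.det = (∏ p, B p p) * A.det := by
  rw [hA, Matrix.det_mul, Matrix.det_of_isLowerTriangular B fun p q h => hB p q h]

theorem prod_pow_fin_val {R : Type*} [CommMonoid R] (a : R) (k : ℕ) :
    ∏ p : Fin (k + 1), a ^ (p : ℕ) = a ^ (k * (k + 1) / 2) := by
  rw [Finset.prod_pow_eq_pow_sum, Fin.sum_univ_eq_sum_range (fun i => i), Finset.sum_range_id,
    Nat.add_sub_cancel, mul_comm]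

end LowerTriangular

/-! ### Higher chain rule with triangular coefficients. -/

section FaaDiBruno

/-- The coefficients `b p q` in the formula `(g ∘ φ)^{(p)} = ∑_q (b p q) (g^{(q)} ∘ φ)`. -/
noncomputable def bellCoeff (φ : ℂ → ℂ) : ℕ → ℕ → ℂ → ℂ
  | 0, 0 => 1
  | 0, _ + 1 => 0
  -- Differentiating `b p q · (g^{(q)} ∘ φ)` either hits the coefficient, or raises `q` by one and
  -- produces a factor `φ'`.
  | p + 1, 0 => deriv (bellCoeff φ p 0)
  | p + 1, q + 1 => deriv (bellCoeff φ p (q + 1)) + deriv φ * bellCoeff φ p q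

variable {φ : ℂ → ℂ}

theorem contDiff_bellCoeff (hφ : ContDiff ℂ ω φ) (p q : ℕ) : ContDiff ℂ ω (bellCoeff φ p q) := by
  -- No regularity is lost, since `ω + 1 = ω`.
  have hd : ∀ {f : ℂ → ℂ}, ContDiff ℂ ω f → ContDiff ℂ ω (deriv f) := fun {f} hf =>
    ((contDiff_succ_iff_deriv (n := ω)).1 (by simpa using hf)).2.2
  induction p generalizing q with
  | zero => cases q <;> simp only [bellCoeff] <;> exact contDiff_const
  | succ p ih =>
    cases q with
    | zero => exact hd (ih 0)
    | succ q => exact (hd (ih (q + 1))).add ((hd hφ).mul (ih q))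

theorem bellCoeff_eq_zero {p q : ℕ} (h : p < q) : bellCoeff φ p q = 0 := by
  induction p generalizing q with
  | zero =>
    obtain ⟨q, rfl⟩ := Nat.exists_eq_succ_of_ne_zero h.ne'
    rfl
  | succ p ih =>
    obtain ⟨q, rfl⟩ := Nat.exists_eq_succ_of_ne_zero (Nat.ne_zero_of_lt h)
    simp only [bellCoeff, ih (show p < q by omega), ih (show p < q + 1 by omega), mul_zero,
      add_zero]
    exact deriv_const' 0

/-- In the recursion for `b (p+1) (p+1)` the term `b p (p+1)` is zero, so each step only multiplies
by `φ'`. -/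
theorem bellCoeff_self (p : ℕ) : bellCoeff φ p p = deriv φ ^ p := by
  induction p with
  | zero => rfl
  | succ p ih =>
    have : deriv (0 : ℂ → ℂ) = 0 := deriv_const' 0
    simp [bellCoeff, ih, bellCoeff_eq_zero (Nat.lt_succ_self p), this, pow_succ']

/-- The identity is needed only at `t₀`, but the induction differentiates it and therefore must
carry it on a neighbourhood. -/
theorem iteratedDeriv_comp_eventuallyEq {g : ℂ → ℂ} (hφ : ContDiff ℂ ω φ) {t₀ : ℂ}
    (hg : AnalyticAt ℂ g (φ t₀)) (p : ℕ) :
    ∀ᶠ t in nhds t₀, iteratedDeriv p (g ∘ φ) t =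
      ∑ q ∈ Finset.range (p + 1), bellCoeff φ p q t * iteratedDeriv q g (φ t) := by
  have hg' : ∀ᶠ t in nhds t₀, AnalyticAt ℂ g (φ t) :=
    hφ.continuous.continuousAt.eventually hg.eventually_analyticAt
  have hφd : ∀ t, DifferentiableAt ℂ φ t := fun t => hφ.contDiffAt.differentiableAt (by simp)
  induction p with
  | zero => simp [bellCoeff]
  | succ p ih =>
    filter_upwards [ih.eventually_nhds, hg'] with t ht hgt
    have hb : ∀ q, DifferentiableAt ℂ (bellCoeff φ p q) t := fun q =>
      (contDiff_bellCoeff hφ p q).contDiffAt.differentiableAt (by simp)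
    have hgq : ∀ q, HasDerivAt (fun t => iteratedDeriv q g (φ t))
        (iteratedDeriv (q + 1) g (φ t) * deriv φ t) t := fun q => by
      have h1 : AnalyticAt ℂ (iteratedDeriv q g) (φ t) := by
        rw [iteratedDeriv_eq_iterate]
        exact hgt.iterated_deriv q
      have := h1.differentiableAt.hasDerivAt.comp t (hφd t).hasDerivAt
      rwa [← iteratedDeriv_succ] at this
    have key : HasDerivAt
        (fun t => ∑ q ∈ Finset.range (p + 1), bellCoeff φ p q t * iteratedDeriv q g (φ t))
        (∑ q ∈ Finset.range (p + 1), (deriv (bellCoeff φ p q) t * iteratedDeriv q g (φ t) +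
          bellCoeff φ p q t * (iteratedDeriv (q + 1) g (φ t) * deriv φ t))) t :=
      HasDerivAt.fun_sum fun q _ => (hb q).hasDerivAt.mul (hgq q)
    rw [iteratedDeriv_succ, Filter.EventuallyEq.deriv_eq ht, key.deriv, Finset.sum_add_distrib,
      Finset.sum_range_succ' _ (p + 1)]
    simp only [bellCoeff, Pi.add_apply, Pi.mul_apply, add_mul, Finset.sum_add_distrib]
    -- The sum may be extended to `q = p + 1`, where the coefficient vanishes; then the term `q = 0`
    -- is split off.
    have e : ∑ q ∈ Finset.range (p + 1), deriv (bellCoeff φ p q) t * iteratedDeriv q g (φ t) =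
        ∑ q ∈ Finset.range (p + 1),
          deriv (bellCoeff φ p (q + 1)) t * iteratedDeriv (q + 1) g (φ t) +
          deriv (bellCoeff φ p 0) t * iteratedDeriv 0 g (φ t) := by
      rw [← Finset.sum_range_succ' (fun q => deriv (bellCoeff φ p q) t * iteratedDeriv q g (φ t)),
        Finset.sum_range_succ _ (p + 1), bellCoeff_eq_zero (Nat.lt_succ_self p)]
      have : deriv (0 : ℂ → ℂ) = 0 := deriv_const' 0
      simp [this]
    rw [e, add_right_comm]
    congr 2
    exact Finset.sum_congr rfl fun q _ => by ring

end FaaDiBruno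

/-! ### Analytic dependence of derivatives on parameters. -/

section AnalyticDependence

variable {E : Type*} [NormedAddCommGroup E] [NormedSpace ℂ E]

/-- Derivatives with respect to a parameter of an analytic function are analytic. -/
theorem analyticAt_iteratedDeriv_snd {G : E × ℂ → ℂ} {z : E × ℂ} (hG : AnalyticAt ℂ G z) (p : ℕ) :
    AnalyticAt ℂ (fun y : E × ℂ => iteratedDeriv p (fun t => G (y.1, t)) y.2) z := by
  induction p with
  | zero => simpa using hG
  | succ p ih =>
    -- The next `t`-derivative is the Fréchet derivative in the direction `(0, 1)`, hence jointly
    -- analytic again.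
    have h1 : AnalyticAt ℂ (fun y : E × ℂ =>
        fderiv ℂ (fun y : E × ℂ => iteratedDeriv p (fun t => G (y.1, t)) y.2) y (0, 1)) z :=
      ((ContinuousLinearMap.apply ℂ ℂ ((0, 1) : E × ℂ)).analyticAt _).comp ih.fderiv
    refine h1.congr ?_
    filter_upwards [ih.eventually_analyticAt] with y hy
    have h2 : HasDerivAt (fun t : ℂ => (y.1, t)) (0, 1) y.2 :=
      (hasDerivAt_const _ _).prodMk (hasDerivAt_id _)
    have h3 := hy.differentiableAt.hasFDerivAt.comp_hasDerivAt y.2 h2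
    rw [iteratedDeriv_succ]
    exact h3.deriv.symm

end AnalyticDependence

/-! ### Polynomial curves with prescribed jet. -/

section TaylorPolynomial

variable {E : Type*} [NormedAddCommGroup E] [NormedSpace ℂ E]

/-- The polynomial curve with derivatives `v 0, …, v k` at `0`. -/
noncomputable def taylorCurve {k : ℕ} (v : Fin (k + 1) → E) (t : ℂ) : E :=
  ∑ i : Fin (k + 1), (t ^ (i : ℕ) / (i : ℕ).factorial) • v i

theorem taylorCurve_zero {k : ℕ} (v : Fin (k + 1) → E) : taylorCurve v 0 = v 0 := by
  simp [taylorCurve, Fin.sum_univ_succ]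

theorem contDiff_taylorCurve {k : ℕ} (v : Fin (k + 1) → E) {m : WithTop ℕ∞} :
    ContDiff ℂ m (taylorCurve v) := by
  unfold taylorCurve
  fun_prop

theorem iteratedDeriv_taylorCurve {k : ℕ} (v : Fin (k + 1) → E) (p : Fin (k + 1)) :
    iteratedDeriv p (taylorCurve v) 0 = v p := by
  unfold taylorCurve
  rw [iteratedDeriv_fun_sum fun i _ => by fun_prop]
  rw [Finset.sum_eq_single p]
  · rw [iteratedDeriv_smul_const (by fun_prop), iteratedDeriv_div_const,
      iteratedDeriv_fun_pow_zero]
    simp [Nat.factorial_ne_zero]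
  · intro i _ hi
    rw [iteratedDeriv_smul_const (by fun_prop), iteratedDeriv_div_const,
      iteratedDeriv_fun_pow_zero, if_neg fun h => hi (Fin.ext h.symm)]
    simp
  · simp

/-- `F (taylorCurve v t)` is jointly analytic in `(v, t)`; its `t`-derivatives stay so, and
restricting to `t = 0` leaves an analytic function of `v`. -/
theorem analyticAt_iteratedDeriv_comp_taylorCurve {k : ℕ} {F : E → ℂ} {v : Fin (k + 1) → E}
    (hF : AnalyticAt ℂ F (v 0)) (p : ℕ) :
    AnalyticAt ℂ (fun v : Fin (k + 1) → E => iteratedDeriv p (F ∘ taylorCurve v) 0) v := by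
  have hT : AnalyticAt ℂ (fun y : (Fin (k + 1) → E) × ℂ => taylorCurve y.1 y.2) (v, 0) := by
    unfold taylorCurve
    refine Finset.analyticAt_fun_sum _ fun i _ => AnalyticAt.smul ?_ ?_
    · simp only [div_eq_mul_inv]
      exact (analyticAt_snd.pow _).mul analyticAt_const
    · exact ((ContinuousLinearMap.proj (R := ℂ) (φ := fun _ : Fin (k + 1) => E) i).analyticAt
        _).comp analyticAt_fst
  have hG : AnalyticAt ℂ (fun y : (Fin (k + 1) → E) × ℂ => F (taylorCurve y.1 y.2)) (v, 0) :=
    AnalyticAt.comp (by simpa only [taylorCurve_zero] using hF) hT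
  exact (analyticAt_iteratedDeriv_snd hG p).comp (f := fun v : Fin (k + 1) → E => (v, (0 : ℂ)))
    (analyticAt_id.prod analyticAt_const)

end TaylorPolynomial

end JetDifferentials

namespace JetDifferentials

open Bundle TensorProduct TopologicalSpace

/-! ### Holomorphy, invariance and rescaling of local Wronskians. -/

section LocalWronskian

variable {n : ℕ} {X : Type*} [TopologicalSpace X] [ChartedSpace (Cn n) X]

theorem IsHolomorphicOn.contDiffAt_comp {U : Opens X} {f : X → ℂ} (hf : IsHolomorphicOn n U f)
    (γ : CurveGerm n X) (hγ : γ.toFun 0 ∈ U) : ContDiffAt ℂ ω (f ∘ γ.toFun) 0 :=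
  ((hf.contMDiffAt (U.isOpen.mem_nhds hγ)).comp 0 γ.holomorphic_at_zero).contDiffAt

/-- The coordinate expression of a holomorphic function is holomorphic. -/
theorem IsHolomorphicOn.analyticAt_chart [IsManifold 𝓘(ℂ, Cn n) ω X] {U : Opens X} {f : X → ℂ}
    (hf : IsHolomorphicOn n U f) {φ : OpenPartialHomeomorph X (Cn n)}
    (hφ : φ ∈ IsManifold.maximalAtlas 𝓘(ℂ, Cn n) ω X) {z : Cn n} (hz : z ∈ φ.target)
    (hzU : φ.symm z ∈ U) : AnalyticAt ℂ (f ∘ φ.symm) z :=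
  ContDiffAt.analyticAt
    ((hf.contMDiffAt (U.isOpen.mem_nhds hzU)).comp z
      (contMDiffAt_symm_of_mem_maximalAtlas hφ hz)).contDiffAt

variable [IsManifold 𝓘(ℂ, Cn n) ω X]

/-- Derivatives up to order `k` see only the jet coordinates, so `φ ∘ γ` may be replaced by
`taylorCurve (jetCoord k φ γ)`, which makes the dependence on the coordinates explicit. -/
theorem isHolomorphicOnJets_jetDiff {k : ℕ} {U : Opens X} {f : X → ℂ}
    (hf : IsHolomorphicOn n U f) (p : Fin (k + 1)) :
    IsHolomorphicOnJets (k := k) (U := U) (jetDiff hf p) := by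
  intro φ hφ
  refine ⟨fun v => iteratedDeriv p ((f ∘ φ.symm) ∘ taylorCurve v) 0, fun v hv =>
    analyticAt_iteratedDeriv_comp_taylorCurve (hf.analyticAt_chart hφ hv.1 hv.2) p,
    fun γ hγ hs => ?_⟩
  have hγU : γ.toFun 0 ∈ U := hγ
  have ev : f ∘ γ.toFun =ᶠ[nhds 0] (f ∘ φ.symm) ∘ (φ ∘ γ.toFun) := by
    filter_upwards [γ.holomorphic_at_zero.continuousAt (φ.open_source.mem_nhds hs)] with t ht
    have ht' : γ.toFun t ∈ φ.source := ht
    simp only [Function.comp_apply, φ.left_inv ht']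
  rw [jetDiff_jet, ev.iteratedDeriv_eq]
  refine iteratedDeriv_comp_congr ?_ ((γ.contDiffAt_chart hφ hs).of_le le_top)
    (contDiff_taylorCurve _).contDiffAt fun i hi => ?_
  · refine (hf.analyticAt_chart hφ (φ.map_source hs) ?_).contDiffAt
    change φ.symm (φ (γ.toFun 0)) ∈ U
    rwa [φ.left_inv hs]
  · exact (iteratedDeriv_taylorCurve (jetCoord k φ γ)
      (⟨i, hi.trans_lt p.2⟩ : Fin (k + 1))).symm

theorem isHolomorphicOnJets_wronskian {k : ℕ} {U : Opens X} {f : Fin (k + 1) → X → ℂ}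
    (hf : ∀ j, IsHolomorphicOn n U (f j)) : IsHolomorphicOnJets (wronskian hf) := by
  intro φ hφ
  choose q hq hq' using fun p j => isHolomorphicOnJets_jetDiff (k := k) (hf j) p φ hφ
  refine ⟨fun v => Matrix.det (Matrix.of fun p j => q p j v), fun v hv => ?_, fun γ hγ hs => ?_⟩
  · simp only [Matrix.det_apply, Matrix.of_apply]
    exact Finset.analyticAt_fun_sum _ fun σ _ => AnalyticAt.const_smul
      (Finset.analyticAt_fun_prod _ fun i _ => hq _ _ v hv)
  · simp only [wronskian, hq' _ _ γ hγ hs]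

/-- For `k = 0` the reparametrization is the zero function, and the factor is `0 ^ 0 = 1`, in
agreement with `bellCoeff φ 0 0 = 1`. -/
theorem wronskian_actOver {k : ℕ} {U : Opens X} {f : Fin (k + 1) → X → ℂ}
    (hf : ∀ j, IsHolomorphicOn n U (f j)) (φ : Reparam k) (w : jetsOver n k U) :
    wronskian hf (φ.actOver w) = deriv φ.toFun 0 ^ (k * (k + 1) / 2) * wronskian hf w := by
  obtain ⟨w, hw⟩ := w
  induction w using Quotient.inductionOn with
  | h γ =>
    have hγ : γ.toFun 0 ∈ U := hw
    change Matrix.det (Matrix.of fun p j : Fin (k + 1) =>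
        iteratedDeriv p ((f j ∘ γ.toFun) ∘ φ.toFun) 0) =
      _ * Matrix.det (Matrix.of fun p j : Fin (k + 1) => iteratedDeriv p (f j ∘ γ.toFun) 0)
    rw [det_eq_prod_mul_det_of_lowerTriangular
      (A := Matrix.of fun p j : Fin (k + 1) => iteratedDeriv p (f j ∘ γ.toFun) 0)
      (B := Matrix.of fun p q : Fin (k + 1) => bellCoeff φ.toFun p q 0)]
    · simp only [Matrix.of_apply, bellCoeff_self, Pi.pow_apply, prod_pow_fin_val]
    · ext p j
      have han : AnalyticAt ℂ (f j ∘ γ.toFun) (φ.toFun 0) := by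
        rw [φ.toFun_zero]
        exact ContDiffAt.analyticAt ((hf j).contDiffAt_comp γ hγ)
      rw [Matrix.of_apply, (iteratedDeriv_comp_eventuallyEq φ.contDiff han p).self_of_nhds,
        φ.toFun_zero, Matrix.mul_apply]
      simp only [Matrix.of_apply]
      rw [Fin.sum_univ_eq_sum_range
        (fun q => bellCoeff φ.toFun p q 0 * iteratedDeriv q (f j ∘ γ.toFun) 0)]
      -- The chain rule sums over `q ≤ p`, the matrix product over `q ≤ k`; the coefficients with `q
      -- > p` vanish.
      refine Finset.sum_subset (Finset.range_subset_range.2 p.2) fun q _ hq => ?_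
      rw [bellCoeff_eq_zero (by simpa using hq)]
      simp
    · intro p q hpq
      simp [bellCoeff_eq_zero (show (p : ℕ) < q from hpq)]

/-- Wronskians of local holomorphic functions are invariant jet differentials. -/
theorem wronskian_mem_invJetDiff {k : ℕ} {U : Opens X} {f : Fin (k + 1) → X → ℂ}
    (hf : ∀ j, IsHolomorphicOn n U (f j)) :
    wronskian hf ∈ invJetDiff n k (k * (k + 1) / 2) U :=
  ⟨isHolomorphicOnJets_wronskian hf, wronskian_actOver hf⟩

/-- `W(g f₀, …, g f_k) = g^{k+1} W(f₀, …, f_k)`. -/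
theorem wronskian_eq_pow_mul {k : ℕ} {U V N : Opens X} {f f' : Fin (k + 1) → X → ℂ} {g : X → ℂ}
    (hf : ∀ j, IsHolomorphicOn n U (f j)) (hf' : ∀ j, IsHolomorphicOn n V (f' j))
    (hg : IsHolomorphicOn n N g) (h : ∀ j, ∀ x ∈ N, f' j x = g x * f j x)
    {w : JetSpace n X k} (hU : w ∈ jetsOver n k U) (hV : w ∈ jetsOver n k V)
    (hN : w ∈ jetsOver n k N) :
    wronskian hf' ⟨w, hV⟩ = g w.base ^ (k + 1) * wronskian hf ⟨w, hU⟩ := by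
  induction w using Quotient.inductionOn with
  | h γ =>
    have hγN : γ.toFun 0 ∈ N := hN
    change Matrix.det (Matrix.of fun p j : Fin (k + 1) => iteratedDeriv p (f' j ∘ γ.toFun) 0) =
      g (γ.toFun 0) ^ (k + 1) *
        Matrix.det (Matrix.of fun p j : Fin (k + 1) => iteratedDeriv p (f j ∘ γ.toFun) 0)
    -- Leibniz matrix. Above the diagonal `p - q` truncates to `0`, but there the binomial
    -- coefficient vanishes.
    rw [det_eq_prod_mul_det_of_lowerTriangular
      (A := Matrix.of fun p j : Fin (k + 1) => iteratedDeriv p (f j ∘ γ.toFun) 0)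
      (B := Matrix.of fun p q : Fin (k + 1) =>
        ((p : ℕ).choose q : ℂ) * iteratedDeriv (p - q : ℕ) (g ∘ γ.toFun) 0)]
    · simp
    · ext p j
      have ev : f' j ∘ γ.toFun =ᶠ[nhds 0] (f j ∘ γ.toFun) * (g ∘ γ.toFun) := by
        filter_upwards [γ.holomorphic_at_zero.continuousAt (N.isOpen.mem_nhds hγN)] with t ht
        simp [h j _ ht, mul_comm]
      rw [Matrix.of_apply, ev.iteratedDeriv_eq,
        iteratedDeriv_mul (((hf j).contDiffAt_comp γ hU).of_le le_top)
          ((hg.contDiffAt_comp γ hγN).of_le le_top), Matrix.mul_apply]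
      simp only [Matrix.of_apply]
      rw [Fin.sum_univ_eq_sum_range (fun q => ((p : ℕ).choose q : ℂ) *
        iteratedDeriv (p - q : ℕ) (g ∘ γ.toFun) 0 * iteratedDeriv q (f j ∘ γ.toFun) 0)]
      rw [← Finset.sum_subset (Finset.range_subset_range.2 p.2)]
      · exact Finset.sum_congr rfl fun q _ => by ring
      · intro q _ hq
        rw [Nat.choose_eq_zero_of_lt (by simpa using hq)]
        simp
    · intro p q hpq
      simp [Nat.choose_eq_zero_of_lt (show (p : ℕ) < q from hpq)]

end LocalWronskian

end JetDifferentials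

namespace JetDifferentials

open Bundle TensorProduct TopologicalSpace

/-! ### Transition functions and gluing. -/

section LineBundle

variable {n : ℕ} {X : Type*} [TopologicalSpace X] [ChartedSpace (Cn n) X]
  {L : X → Type*} [TopologicalSpace (TotalSpace ℂ L)]
  [∀ x, AddCommGroup (L x)] [∀ x, Module ℂ (L x)] [∀ x, TopologicalSpace (L x)]
  [FiberBundle ℂ L]

namespace HolTrivialization

variable (n L) in
/-- The preferred trivialization of the line bundle `L` around a point. -/
noncomputable def preferred [VectorBundle ℂ ℂ L] [ContMDiffVectorBundle ω ℂ L 𝓘(ℂ, Cn n)]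
    (x : X) : HolTrivialization n L where
  toTriv := trivializationAt ℂ L x
  isLinear := inferInstance
  contMDiffOn := Trivialization.contMDiffOn _
  contMDiffOn_symm := Trivialization.contMDiffOn_symm _

theorem mem_domain_preferred [VectorBundle ℂ ℂ L] [ContMDiffVectorBundle ω ℂ L 𝓘(ℂ, Cn n)]
    (x : X) :
    x ∈ (preferred n L x).domain :=
  FiberBundle.mem_baseSet_trivializationAt' x

theorem fiberMap_apply (τ : HolTrivialization n L) {x : X} (hx : x ∈ τ.domain) (v : L x) :
    τ.fiberMap x v = (τ.toTriv ⟨x, v⟩).2 := by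
  have := τ.isLinear
  exact congrFun (τ.toTriv.coe_linearMapAt_of_mem hx) v

theorem fiberMap_symm (τ : HolTrivialization n L) {x : X} (hx : x ∈ τ.domain) (y : ℂ) :
    τ.fiberMap x (τ.toTriv.symm x y) = y := by
  have := τ.isLinear
  exact τ.toTriv.linearMapAt_symm hx y

theorem symm_fiberMap (τ : HolTrivialization n L) {x : X} (hx : x ∈ τ.domain) (v : L x) :
    τ.toTriv.symm x (τ.fiberMap x v) = v := by
  have := τ.isLinear
  exact τ.toTriv.symm_linearMapAt hx v

/-- The transition function from `τ` to `τ'`. -/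
noncomputable def transition (τ τ' : HolTrivialization n L) (x : X) : ℂ :=
  τ'.fiberMap x (τ.toTriv.symm x 1)

/-- The fibre is a line spanned by the vector that `τ` sends to `1`. -/
theorem fiberMap_eq_transition_mul (τ τ' : HolTrivialization n L) {x : X} (hx : x ∈ τ.domain)
    (v : L x) : τ'.fiberMap x v = τ.transition τ' x * τ.fiberMap x v := by
  have hv : v = τ.fiberMap x v • τ.toTriv.symm x 1 := by
    apply Function.LeftInverse.injective (τ.symm_fiberMap hx)
    rw [map_smul, τ.fiberMap_symm hx, smul_eq_mul, mul_one]
  conv_lhs => rw [hv, map_smul, smul_eq_mul, mul_comm]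
  rfl

/-- The transition function is the second component of `τ' ∘ τ⁻¹` along the holomorphic section `x ↦
(x, 1)`. -/
theorem isHolomorphicOn_transition (τ τ' : HolTrivialization n L) :
    IsHolomorphicOn n (τ.domain ⊓ τ'.domain) (τ.transition τ') := by
  have h1 : ContMDiffOn 𝓘(ℂ, Cn n) (𝓘(ℂ, Cn n).prod 𝓘(ℂ, ℂ)) ω (fun x : X => (x, (1 : ℂ)))
      (τ.domain ⊓ τ'.domain : Opens X) := contMDiffOn_id.prodMk contMDiffOn_const
  have h2 : ContMDiffOn 𝓘(ℂ, Cn n) (𝓘(ℂ, Cn n).prod 𝓘(ℂ, ℂ)) ω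
      (fun x : X => τ.toTriv.toOpenPartialHomeomorph.symm (x, (1 : ℂ)))
      (τ.domain ⊓ τ'.domain : Opens X) :=
    τ.contMDiffOn_symm.comp h1 fun x hx => τ.toTriv.mem_target.2 hx.1
  have h3 : ContMDiffOn 𝓘(ℂ, Cn n) (𝓘(ℂ, Cn n).prod 𝓘(ℂ, ℂ)) ω
      (fun x : X => τ'.toTriv (τ.toTriv.toOpenPartialHomeomorph.symm (x, (1 : ℂ))))
      (τ.domain ⊓ τ'.domain : Opens X) :=
    τ'.contMDiffOn.comp h2 fun x hx => by
      have hx' : x ∈ τ.toTriv.baseSet := hx.1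
      rw [Set.mem_preimage, ← τ.toTriv.mk_symm hx', τ'.toTriv.mem_source]
      exact hx.2
  refine (contMDiff_snd.comp_contMDiffOn h3).congr fun x hx => ?_
  have hx' : x ∈ τ.toTriv.baseSet := hx.1
  rw [transition, τ'.fiberMap_apply hx.2, Function.comp_apply, ← τ.toTriv.mk_symm hx']

theorem tensorMap_tprod (τ : HolTrivialization n L) (r : ℕ) (x : X) (v : Fin r → L x) :
    τ.tensorMap r x (PiTensorProduct.tprod ℂ v) = ∏ i, τ.fiberMap x (v i) := by
  simp [tensorMap]

/-- Over the domain `fiberMap` is an isomorphism, so `tensorMap` is its tensor power followed by the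
multiplication isomorphism `ℂ^{⊗ r} ≃ ℂ`. -/
theorem tensorMap_injective (τ : HolTrivialization n L) (r : ℕ) {x : X} (hx : x ∈ τ.domain) :
    Function.Injective (τ.tensorMap r x) := by
  let e : L x ≃ₗ[ℂ] ℂ := LinearEquiv.ofBijective (τ.fiberMap x)
    ⟨Function.LeftInverse.injective (τ.symm_fiberMap hx),
      Function.RightInverse.surjective (τ.fiberMap_symm hx)⟩
  have h : τ.tensorMap r x =
      (PiTensorProduct.constantBaseRingEquiv (Fin r) ℂ).toLinearMap ∘ₗ
        (PiTensorProduct.congr fun _ : Fin r => e).toLinearMap := by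
    ext v
    simp only [LinearMap.compMultilinearMap_apply, tensorMap_tprod, LinearMap.comp_apply,
      LinearEquiv.coe_coe, PiTensorProduct.congr_tprod, AlgEquiv.toLinearMap_apply,
      PiTensorProduct.constantBaseRingEquiv_tprod]
    rfl
  rw [h]
  exact (PiTensorProduct.constantBaseRingEquiv (Fin r) ℂ).injective.comp
    (PiTensorProduct.congr fun _ : Fin r => e).injective

variable [IsManifold 𝓘(ℂ, Cn n) ω X]

theorem wronskian_eq_transition_pow_mul (τ τ' : HolTrivialization n L) {k : ℕ}
    (s : Fin (k + 1) → Cₛ^ω⟮𝓘(ℂ, Cn n); ℂ, L⟯) {w : JetSpace n X k}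
    (hw : w ∈ jetsOver n k τ.domain) (hw' : w ∈ jetsOver n k τ'.domain) :
    τ'.wronskian s ⟨w, hw'⟩ = τ.transition τ' w.base ^ (k + 1) * τ.wronskian s ⟨w, hw⟩ :=
  wronskian_eq_pow_mul _ _ (τ.isHolomorphicOn_transition τ')
    (fun j _ hx => τ.fiberMap_eq_transition_mul τ' hx.1 (s j _)) hw hw' ⟨hw, hw'⟩

end HolTrivialization

variable [VectorBundle ℂ ℂ L] [ContMDiffVectorBundle ω ℂ L 𝓘(ℂ, Cn n)]

/-- A twisted jet differential is determined by its local representatives. -/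
theorem ext_of_rep_eq {k r : ℕ} {σ σ' : ∀ j : JetSpace n X k, ⨂[ℂ] _ : Fin r, L j.base}
    (h : ∀ τ : HolTrivialization n L, τ.rep σ = τ.rep σ') : σ = σ' := by
  funext w
  have hw := HolTrivialization.mem_domain_preferred (n := n) (L := L) w.base
  exact HolTrivialization.tensorMap_injective _ r hw
    (congrFun (h (HolTrivialization.preferred n L w.base)) ⟨w, hw⟩)

variable [IsManifold 𝓘(ℂ, Cn n) ω X]

/-- The `L^{k+1}`-valued Wronskian of global sections of `L`, as a function on the jet space. -/
noncomputable def globalWronskian {k : ℕ} (s : Fin (k + 1) → Cₛ^ω⟮𝓘(ℂ, Cn n); ℂ, L⟯)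
    (w : JetSpace n X k) : ⨂[ℂ] _ : Fin (k + 1), L w.base :=
  -- The trivialization varies with the base point, so holomorphy is not visible here; it comes from
  -- `rep_globalWronskian`.
  (HolTrivialization.preferred n L w.base).wronskian s
      ⟨w, HolTrivialization.mem_domain_preferred w.base⟩ •
    PiTensorProduct.tprod ℂ fun _ => (HolTrivialization.preferred n L w.base).toTriv.symm w.base 1

/-- By definition of `transition`, `τ` sends the chosen tensor to the `(k+1)`-st power of the
transition function, exactly the factor relating the two local Wronskians. -/
theorem HolTrivialization.rep_globalWronskian (τ : HolTrivialization n L) {k : ℕ}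
    (s : Fin (k + 1) → Cₛ^ω⟮𝓘(ℂ, Cn n); ℂ, L⟯) :
    τ.rep (globalWronskian s) = τ.wronskian s := by
  funext ⟨w, hw⟩
  rw [(HolTrivialization.preferred n L w.base).wronskian_eq_transition_pow_mul τ s
    (HolTrivialization.mem_domain_preferred w.base) hw]
  simp only [rep, globalWronskian, map_smul, tensorMap_tprod, Finset.prod_const, Finset.card_univ,
    Fintype.card_fin, smul_eq_mul]
  exact mul_comm _ _

end LineBundle

end JetDifferentials

theorem proposition2p2 {n : ℕ} {X : Type*} [TopologicalSpace X]
    [ChartedSpace (JetDifferentials.Cn n) X]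
    [IsManifold 𝓘(ℂ, JetDifferentials.Cn n) ω X]
    (L : X → Type*) [TopologicalSpace (Bundle.TotalSpace ℂ L)]
    [∀ x, AddCommGroup (L x)] [∀ x, Module ℂ (L x)] [∀ x, TopologicalSpace (L x)]
    [FiberBundle ℂ L] [VectorBundle ℂ ℂ L]
    [ContMDiffVectorBundle ω ℂ L 𝓘(ℂ, JetDifferentials.Cn n)] (k : ℕ) :
    -- invariance of Wronskians of local holomorphic functions
    (∀ (U : TopologicalSpace.Opens X) (f : Fin (k + 1) → X → ℂ)
        (hf : ∀ j, JetDifferentials.IsHolomorphicOn n U (f j)),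
      JetDifferentials.wronskian hf ∈ JetDifferentials.invJetDiff n k (k * (k + 1) / 2) U) ∧
    ∀ s : Fin (k + 1) → Cₛ^ω⟮𝓘(ℂ, JetDifferentials.Cn n); ℂ, L⟯,
      -- invariance of the local Wronskians of global sections
      (∀ τ : JetDifferentials.HolTrivialization n L,
        τ.wronskian s ∈ JetDifferentials.invJetDiff n k (k * (k + 1) / 2) τ.domain) ∧
      -- they are the local representatives of a unique twisted global section
      ∃! W : JetDifferentials.twistedInvJetDiff n L k (k * (k + 1) / 2) (k + 1),
        ∀ τ : JetDifferentials.HolTrivialization n L, τ.rep W.1 = τ.wronskian s := by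
  refine ⟨fun U f hf => JetDifferentials.wronskian_mem_invJetDiff hf, fun s =>
    ⟨fun τ => JetDifferentials.wronskian_mem_invJetDiff _,
      ⟨JetDifferentials.globalWronskian s, fun τ => ?_⟩, fun τ => ?_, fun W hW => ?_⟩⟩
  -- Membership in the twisted space is tested on local representatives, which are the local
  -- Wronskians.
  · rw [τ.rep_globalWronskian s]
    exact JetDifferentials.wronskian_mem_invJetDiff _
  · exact τ.rep_globalWronskian s
  · exact Subtype.ext (JetDifferentials.ext_of_rep_eq fun τ =>
      (hW τ).trans (τ.rep_globalWronskian s).symm)
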